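/- **Conventions.** Let $X$ be a scheme. A *multi-center* in $X$ is a finite family $\{[Y_i,E_i]\}_{i\in I}$ of closed subschemes of $X$ such that each $E_i$ is locally principal (its ideal is locally generated by one element). The *dilatation* $\mathrm{Bl}\{{}^{E_i}_{Y_i}\}_{i\in I}X$ is the $X$-affine scheme which over an affine open $\operatorname{Spec}A\subset X$ with $Y_i=V(M_i)$, $E_i=V(a_i)$ is the spectrum of the $A$-subalgebra of $A[a_i^{-1}: i\in I]$ generated by all $m/a_i$ with $i\in I$, $m\in M_i$. It represents the functor on $X$-schemes $f:T\to X$ for which all $f^{-1}(E_i)$ are effective Cartier divisors which sends $T$ to a one-point set if $f^{-1}(E_i)\subset f^{-1}(Y_i)$ for all $i$, and to $\varnothing$ otherwise. For a finite totally ordered set $I$, a decreasing family $(X_i)_{i\in I}$ of closed subschemes of $X$ ($i\ge i'$ implies $X_i\subset X_{i'}$) and locally principal closed subschemes $(D_i)_{i\in I}$ of $X$, the *deformation space* is $$\mathbb D\big(({}^{D_i}_{X_i})_{i\in I}\,{}_X\big)=\mathrm{Bl}\Big\{{}^{\sum_{j\ge i}D_j}_{X_i}\Big\}_{i\in I}X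 ,$$ where the sum of closed subschemes is defined by the product of their ideals. If $X'$ is an $X$-scheme and $(X_i')$ is a decreasing family of closed subschemes of $X'$, then $\mathbb D\big(({}^{D_i}_{X'_i})_{i}\,{}_{X'}\big)$ is formed with the pullbacks of the $D_i$ to $X'$; similarly, $\mathbb D\big(({}^{D_s}_{X_s})_{s}\,{}_{X_k}\big)$, where $X_s\subset X_k$ for all $s$, is formed over $X_k$ with $X_s$ viewed as a closed subscheme of $X_k$. **Setting.** Let $I$, $X$, $(X_i)_{i\in I}$, $(D_i)_{i\in I}$ be as above, and assume that $X_i\cap D_j$ is an effective Cartier divisor in $X_i$ for all $i,j\in I$. Let $S\subset I$, $K=I\setminus S$, $S_{>k}=\{s\in S: s>k\}$, $Z=\bigcap_{s\in S}D_s$ (with $Z=X$ if $S=\varnothing$), and put $$P=\mathbb D\big(({}^{D_s}_{X_s})_{s\in S}\,{}_X\big),\qquad Q_k=\mathbb D\big(({}^{D_s}_{X_s})_{s\in S_{>k}}\,{}_{X_k}\big)\quad(k\in K).$$ For $k\in K$ there is a unique $X$-morphism $Q_k\to P$; it is a closed immersion, by which $Q_k$ is viewed as a closed subscheme of $P$.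 The *$S$-panel* is $$\mathbb D_S=\mathbb D\big(({}^{D_k}_{Q_k})_{k\in K}\,{}_P\big).$$ **Theorem.** Assume that for every $k\in K$ the inverse image of $D_k\cap Z$ under the projection $\mathbb D_S\times_X Z\to Z$ is an effective Cartier divisor in $\mathbb D_S\times_X Z$. Then there is a unique isomorphism of $P\times_X Z$-schemes $$\mathbb D_S\times_X Z\;\xrightarrow{\ \sim\ }\;\mathbb D\big(({}^{D_k}_{Q_k\times_X Z})_{k\in K}\,{}_{P\times_X Z}\big),$$ where $Q_k\times_X Z$ is viewed as a closed subscheme of $P\times_X Z$ by base change of $Q_k\to P$. -/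

import Mathlib

open CategoryTheory Limits AlgebraicGeometry TopologicalSpace
universe u v
namespace AlgebraicGeometry.Scheme.IdealSheafData
variable {X Y : Scheme.{u}}

theorem ideal_comap_top_of_isAffine [IsAffine X] [IsAffine Y] (I : Y.IdealSheafData) (f : X ⟶ Y) :
    (I.comap f).ideal ⟨⊤, isAffineOpen_top X⟩ =
      (I.ideal ⟨⊤, isAffineOpen_top Y⟩).map f.appTop.hom := by
  apply le_antisymm
  · have h : I.comap f ≤ ofIdealTop ((I.ideal ⟨⊤, isAffineOpen_top Y⟩).map f.appTop.hom) := by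
      rw [← le_map_iff_comap_le]
      apply le_of_isAffine
      rw [ideal_map _ _ _ (isAffineOpen_top X)]
      rw [← Ideal.map_le_iff_le_comap]
      have := (equivOfIsAffine (X := X)).right_inv ((I.ideal ⟨⊤, isAffineOpen_top Y⟩).map f.appTop.hom)
      exact this.ge
    have h2 := h ⟨⊤, isAffineOpen_top X⟩
    have := (equivOfIsAffine (X := X)).right_inv ((I.ideal ⟨⊤, isAffineOpen_top Y⟩).map f.appTop.hom)
    exact h2.trans this.le
  · rw [Ideal.map_le_iff_le_comap]
    have := I.le_map_comap f ⟨⊤, isAffineOpen_top Y⟩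
    rwa [ideal_map _ _ _ (isAffineOpen_top X)] at this

theorem ideal_comap_fromSpec (I : X.IdealSheafData) {U : X.Opens} (hU : IsAffineOpen U) :
    (I.comap hU.fromSpec).ideal ⟨⊤, isAffineOpen_top (Spec Γ(X, U))⟩ =
      (I.ideal ⟨U, hU⟩).map (Scheme.ΓSpecIso Γ(X, U)).inv.hom := by
  refine (ideal_comap_of_isOpenImmersion I hU.fromSpec ⟨⊤, isAffineOpen_top _⟩).trans ?_
  have hle : hU.fromSpec ''ᵁ ⊤ ≤ U := by simp
  have e1 := I.map_ideal (U := ⟨hU.fromSpec ''ᵁ ⊤, (isAffineOpen_top _).image_of_isOpenImmersion _⟩)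
    (V := ⟨U, hU⟩) hle
  change Ideal.comap _ (I.ideal ⟨hU.fromSpec ''ᵁ ⊤,
    (isAffineOpen_top _).image_of_isOpenImmersion _⟩) = _
  rw [← e1]
  have e2 : ∀ J : Ideal Γ(X, hU.fromSpec ''ᵁ ⊤), J.comap (hU.fromSpec.appIso ⊤).inv.hom =
      J.map (hU.fromSpec.appIso ⊤).hom.hom := fun J ↦
    (Ideal.map_comap_of_equiv (I := J) (hU.fromSpec.appIso ⊤).commRingCatIsoToRingEquiv).symm
  refine (e2 _).trans ?_
  rw [Ideal.map_map, ← CommRingCat.hom_comp, Scheme.Hom.appIso_hom', Scheme.Hom.map_appLE,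
    Scheme.Hom.appLE]
  change Ideal.map (hU.fromSpec.app U ≫ _).hom _ = _
  rw [IsAffineOpen.fromSpec_app_self, Category.assoc, ← Functor.map_comp]
  have : ∀ (g : Opposite.op (⊤ : (Spec Γ(X, U)).Opens) ⟶ Opposite.op ⊤),
      (Spec Γ(X, U)).presheaf.map g = 𝟙 _ := fun g ↦ by
    rw [Subsingleton.elim g (𝟙 _), CategoryTheory.Functor.map_id]
  rw [this, Category.comp_id]

theorem ideal_comap (I : Y.IdealSheafData) (f : X ⟶ Y) {U : Y.Opens} (hU : IsAffineOpen U)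
    {V : X.Opens} (hV : IsAffineOpen V) (h : V ≤ f ⁻¹ᵁ U) :
    (I.comap f).ideal ⟨V, hV⟩ = (I.ideal ⟨U, hU⟩).map (f.appLE U V h).hom := by
  have e : Spec.map (f.appLE U V h) ≫ hU.fromSpec = hV.fromSpec ≫ f :=
    IsAffineOpen.SpecMap_appLE_fromSpec f hU hV h
  have h1 := ideal_comap_top_of_isAffine (I.comap hU.fromSpec) (Spec.map (f.appLE U V h))
  rw [← comap_comp, e, comap_comp, ideal_comap_fromSpec, ideal_comap_fromSpec, Ideal.map_map,
    ← CommRingCat.hom_comp, ← Scheme.ΓSpecIso_inv_naturality, CommRingCat.hom_comp,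
    ← Ideal.map_map] at h1
  have h2 := congrArg (Ideal.map (Scheme.ΓSpecIso Γ(X, V)).hom.hom) h1
  simpa [Ideal.map_map, ← CommRingCat.hom_comp] using h2

theorem ideal_comap_span (I : Y.IdealSheafData) (f : X ⟶ Y) {U : Y.Opens} (hU : IsAffineOpen U)
    {V : X.Opens} (hV : IsAffineOpen V) (h : V ≤ f ⁻¹ᵁ U) {a : Γ(Y, U)}
    (ha : I.ideal ⟨U, hU⟩ = Ideal.span {a}) :
    (I.comap f).ideal ⟨V, hV⟩ = Ideal.span {(f.appLE U V h).hom a} := by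
  rw [ideal_comap I f hU hV h, ha, Ideal.map_span, Set.image_singleton]

theorem ideal_span_of_le (I : X.IdealSheafData) {U : X.Opens} (hU : IsAffineOpen U)
    {V : X.Opens} (hV : IsAffineOpen V) (h : V ≤ U) {a : Γ(X, U)}
    (ha : I.ideal ⟨U, hU⟩ = Ideal.span {a}) :
    I.ideal ⟨V, hV⟩ = Ideal.span {(X.presheaf.map (homOfLE h).op).hom a} := by
  rw [← I.map_ideal (U := ⟨V, hV⟩) (V := ⟨U, hU⟩) h, ha, Ideal.map_span, Set.image_singleton]
  rfl

/-- A closed subscheme (given by its ideal sheaf) is locally principal if its ideal is locally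
generated by one element. -/
def IsLocallyPrincipal (I : X.IdealSheafData) : Prop :=
  ∀ x : X, ∃ (U : X.Opens) (hU : IsAffineOpen U), x ∈ U ∧
    ∃ a : Γ(X, U), I.ideal ⟨U, hU⟩ = Ideal.span {a}

/-- A closed subscheme (given by its ideal sheaf) is an (effective) Cartier divisor if its ideal
is locally generated by one non-zero-divisor. -/
def IsCartier (I : X.IdealSheafData) : Prop :=
  ∀ x : X, ∃ (U : X.Opens) (hU : IsAffineOpen U), x ∈ U ∧
    ∃ a ∈ nonZeroDivisors Γ(X, U), I.ideal ⟨U, hU⟩ = Ideal.span {a}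

theorem IsCartier.isLocallyPrincipal {I : X.IdealSheafData} (h : I.IsCartier) :
    I.IsLocallyPrincipal := fun x ↦
  let ⟨U, hU, hx, a, _, ha⟩ := h x
  ⟨U, hU, hx, a, ha⟩

theorem exists_principal {ι : Type v} [Finite ι] {D : ι → X.IdealSheafData}
    (hD : ∀ i, (D i).IsLocallyPrincipal) (x : X) (O : X.Opens) (hx : x ∈ O) :
    ∃ (U : X.Opens) (hU : IsAffineOpen U), x ∈ U ∧ U ≤ O ∧
      ∀ i, ∃ a : Γ(X, U), (D i).ideal ⟨U, hU⟩ = Ideal.span {a} := by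
  choose U hU hxU a ha using fun i ↦ hD i x
  have hopen : IsOpen ((O : Set X) ∩ ⋂ i, (U i : Set X)) :=
    O.2.inter (isOpen_iInter_of_finite fun i ↦ (U i).2)
  obtain ⟨_, ⟨V, hV, rfl⟩, hxV, hVO⟩ := X.isBasis_affineOpens.exists_subset_of_mem_open
    (show x ∈ ((O : Set X) ∩ ⋂ i, (U i : Set X)) from ⟨hx, Set.mem_iInter.mpr hxU⟩) hopen
  exact ⟨V, hV, hxV, fun y hy ↦ (hVO hy).1, fun i ↦
    ⟨_, ideal_span_of_le _ (hU i) hV (fun y hy ↦ Set.mem_iInter.mp (hVO hy).2 i) (ha i)⟩⟩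

theorem mem_nonZeroDivisors_basicOpen {U : X.Opens} (hU : IsAffineOpen U) (f : Γ(X, U))
    {a : Γ(X, U)} (ha : a ∈ nonZeroDivisors Γ(X, U)) :
    (X.presheaf.map (homOfLE (X.basicOpen_le f)).op).hom a ∈
      nonZeroDivisors Γ(X, X.basicOpen f) := by
  have := hU.isLocalization_basicOpen f
  exact IsLocalization.map_nonZeroDivisors_le (Submonoid.powers f) Γ(X, X.basicOpen f)
    ⟨a, ha, rfl⟩

theorem mem_nonZeroDivisors_of_span_eq {R : Type*} [CommRing R] {a b : R}
    (h : Ideal.span {a} = Ideal.span {b}) (ha : a ∈ nonZeroDivisors R) :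
    b ∈ nonZeroDivisors R := by
  obtain ⟨c, rfl⟩ := Ideal.mem_span_singleton.mp (h ▸ Ideal.mem_span_singleton_self a)
  exact (mul_mem_nonZeroDivisors.mp ha).1

theorem IsCartier.mem_nonZeroDivisors {I : X.IdealSheafData} (h : I.IsCartier) {V : X.Opens}
    (hV : IsAffineOpen V) {b : Γ(X, V)} (hb : I.ideal ⟨V, hV⟩ = Ideal.span {b}) :
    b ∈ nonZeroDivisors Γ(X, V) := by
  rw [mem_nonZeroDivisors_iff_right]
  intro c hc
  choose U hU hxU a ha ha' using h
  choose f g hfg hf using fun x : V ↦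
    exists_basicOpen_le_affine_inter (hU x.1) hV x.1 ⟨hxU x.1, x.2⟩
  refine X.IsSheaf.section_ext fun x hx ↦ ⟨X.basicOpen (g ⟨x, hx⟩), X.basicOpen_le _,
    hfg ⟨x, hx⟩ ▸ hf ⟨x, hx⟩, ?_⟩
  have h1 := ideal_span_of_le I (hU x) ((hU x).basicOpen (f ⟨x, hx⟩)) (X.basicOpen_le _) (ha' x)
  have h2 := mem_nonZeroDivisors_basicOpen (hU x) (f ⟨x, hx⟩) (ha x)
  have h3 := ideal_span_of_le I hV (hV.basicOpen (g ⟨x, hx⟩)) (X.basicOpen_le _) hb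
  have key : ∀ (W : X.Opens) (hW : IsAffineOpen W) (e : X.basicOpen (g ⟨x, hx⟩) = W)
      (a : Γ(X, W)), a ∈ nonZeroDivisors Γ(X, W) → I.ideal ⟨W, hW⟩ = Ideal.span {a} →
      (X.presheaf.map (homOfLE (X.basicOpen_le (g ⟨x, hx⟩))).op).hom b ∈
      nonZeroDivisors Γ(X, X.basicOpen (g ⟨x, hx⟩)) := by
    rintro _ hW rfl a ha h
    exact mem_nonZeroDivisors_of_span_eq (h.symm.trans h3) ha
  have h4 := key _ _ (hfg ⟨x, hx⟩).symm _ h2 h1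
  rw [mem_nonZeroDivisors_iff_right] at h4
  refine (h4 _ ?_).trans (map_zero _).symm
  rw [← map_mul, hc, map_zero]

theorem IsCartier.mem_nonZeroDivisors_of_le {I : X.IdealSheafData} (h : I.IsCartier)
    {V : X.Opens} (hV : IsAffineOpen V) {b : Γ(X, V)} (hb : I.ideal ⟨V, hV⟩ = Ideal.span {b})
    {O : X.Opens} (hO : O ≤ V) :
    (X.presheaf.map (homOfLE hO).op).hom b ∈ nonZeroDivisors Γ(X, O) := by
  rw [mem_nonZeroDivisors_iff_right]
  intro c hc
  refine X.IsSheaf.section_ext fun x hx ↦ ?_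
  obtain ⟨_, ⟨W, hW, rfl⟩, hxW, hWO⟩ := X.isBasis_affineOpens.exists_subset_of_mem_open hx O.2
  replace hWO : W ≤ O := hWO
  refine ⟨W, hWO, hxW, ?_⟩
  have h1 := h.mem_nonZeroDivisors hW (ideal_span_of_le I hV hW (hWO.trans hO) hb)
  rw [mem_nonZeroDivisors_iff_right] at h1
  refine (h1 _ ?_).trans (map_zero _).symm
  have e : (X.presheaf.map (homOfLE (hWO.trans hO)).op).hom b =
      (X.presheaf.map (homOfLE hWO).op).hom ((X.presheaf.map (homOfLE hO).op).hom b) := by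
    rw [← CommRingCat.comp_apply, ← Functor.map_comp]
    rfl
  rw [e, ← map_mul, hc, map_zero]

theorem IsCartier.of_forall {I : X.IdealSheafData} (h : I.IsLocallyPrincipal)
    (H : ∀ (U : X.Opens) (hU : IsAffineOpen U) (a : Γ(X, U)), I.ideal ⟨U, hU⟩ = Ideal.span {a} →
      a ∈ nonZeroDivisors Γ(X, U)) : I.IsCartier := fun x ↦
  let ⟨U, hU, hx, a, ha⟩ := h x
  ⟨U, hU, hx, a, H U hU a ha, ha⟩

theorem IsLocallyPrincipal.mul {I J : X.IdealSheafData} (hI : I.IsLocallyPrincipal)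
    (hJ : J.IsLocallyPrincipal) : (I * J).IsLocallyPrincipal := fun x ↦ by
  obtain ⟨U, hU, hx, -, H⟩ := exists_principal (ι := Bool) (D := fun b ↦ cond b I J)
    (by rintro (_ | _) <;> assumption) x ⊤ trivial
  obtain ⟨a, ha⟩ := H true
  obtain ⟨b, hb⟩ := H false
  refine ⟨U, hU, hx, a * b, ?_⟩
  simp only [cond_true, cond_false] at ha hb
  rw [ideal_mul, Pi.mul_apply, ha, hb, Ideal.span_singleton_mul_span_singleton]

theorem IsCartier.mul {I J : X.IdealSheafData} (hI : I.IsCartier)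
    (hJ : J.IsCartier) : (I * J).IsCartier := fun x ↦ by
  obtain ⟨U, hU, hx, -, H⟩ := exists_principal (ι := Bool) (D := fun b ↦ cond b I J)
    (by rintro (_ | _); exacts [hJ.isLocallyPrincipal, hI.isLocallyPrincipal]) x ⊤ trivial
  obtain ⟨a, ha⟩ := H true
  obtain ⟨b, hb⟩ := H false
  simp only [cond_true, cond_false] at ha hb
  refine ⟨U, hU, hx, a * b, mul_mem (hI.mem_nonZeroDivisors hU ha) (hJ.mem_nonZeroDivisors hU hb),
    ?_⟩
  rw [ideal_mul, Pi.mul_apply, ha, hb, Ideal.span_singleton_mul_span_singleton]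

theorem isCartier_one : (1 : X.IdealSheafData).IsCartier := fun x ↦ by
  obtain ⟨_, ⟨V, hV, rfl⟩, hxV, -⟩ := X.isBasis_affineOpens.exists_subset_of_mem_open
    (Set.mem_univ x) isOpen_univ
  exact ⟨V, hV, hxV, 1, one_mem _, by simp⟩

theorem IsLocallyPrincipal.prod {ι : Type v} (s : Finset ι) {D : ι → X.IdealSheafData}
    (hD : ∀ i ∈ s, (D i).IsLocallyPrincipal) : (∏ i ∈ s, D i).IsLocallyPrincipal :=
  Finset.prod_induction D IsLocallyPrincipal (fun _ _ ↦ .mul) isCartier_one.isLocallyPrincipal hD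

theorem IsCartier.prod {ι : Type v} (s : Finset ι) {D : ι → X.IdealSheafData}
    (hD : ∀ i ∈ s, (D i).IsCartier) : (∏ i ∈ s, D i).IsCartier :=
  Finset.prod_induction D IsCartier (fun _ _ ↦ .mul) isCartier_one hD

theorem exists_affine_le (f : X ⟶ Y) (x : X) (U : Y.Opens) (hx : f x ∈ U) :
    ∃ V : X.Opens, IsAffineOpen V ∧ x ∈ V ∧ V ≤ f ⁻¹ᵁ U := by
  obtain ⟨_, ⟨V, hV, rfl⟩, hxV, h⟩ := X.isBasis_affineOpens.exists_subset_of_mem_open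
    (show x ∈ ((f ⁻¹ᵁ U : X.Opens) : Set X) from hx) (f ⁻¹ᵁ U).2
  exact ⟨V, hV, hxV, h⟩

theorem IsLocallyPrincipal.comap {I : Y.IdealSheafData} (h : I.IsLocallyPrincipal) (f : X ⟶ Y) :
    (I.comap f).IsLocallyPrincipal := fun x ↦ by
  obtain ⟨U, hU, hx, a, ha⟩ := h (f x)
  obtain ⟨V, hV, hxV, hVU⟩ := exists_affine_le f x U hx
  exact ⟨V, hV, hxV, _, ideal_comap_span I f hU hV hVU ha⟩

theorem IsCartier.comap_of_isOpenImmersion {I : Y.IdealSheafData} (h : I.IsCartier) (f : X ⟶ Y)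
    [IsOpenImmersion f] : (I.comap f).IsCartier := fun x ↦ by
  obtain ⟨U, hU, hx, a, -, ha⟩ := h (f x)
  obtain ⟨V, hV, hxV, hVU⟩ := exists_affine_le f x U hx
  refine ⟨V, hV, hxV, _, ?_, ideal_comap_span I f hU hV hVU ha⟩
  have hle : f ''ᵁ V ≤ U := by rintro _ ⟨y, hy, rfl⟩; exact hVU hy
  have h1 := h.mem_nonZeroDivisors (hV.image_of_isOpenImmersion f)
    (ideal_span_of_le I hU (hV.image_of_isOpenImmersion f) hle ha)
  have h2 := (MulEquivClass.map_nonZeroDivisors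
    (f.appIso V).commRingCatIsoToRingEquiv).le ⟨_, h1, rfl⟩
  convert h2 using 1
  change _ = (f.appIso V).hom.hom _
  rw [Scheme.Hom.appIso_hom', ← CommRingCat.comp_apply, Scheme.Hom.map_appLE]

theorem comap_mul (I J : Y.IdealSheafData) (f : X ⟶ Y) :
    (I * J).comap f = I.comap f * J.comap f := by
  have H : ∀ x : X, ∃ (U : Y.Opens) (_ : IsAffineOpen U) (V : X.Opens), IsAffineOpen V ∧ x ∈ V ∧
      V ≤ f ⁻¹ᵁ U := fun x ↦ by
    obtain ⟨_, ⟨U, hU, rfl⟩, hxU, -⟩ := Y.isBasis_affineOpens.exists_subset_of_mem_open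
      (Set.mem_univ (f x)) isOpen_univ
    exact ⟨U, hU, exists_affine_le f x U hxU⟩
  choose U hU V hV hxV hVU using H
  refine ext_of_iSup_eq_top (fun x ↦ ⟨V x, hV x⟩)
    (top_le_iff.mp fun x _ ↦ Opens.mem_iSup.mpr ⟨x, hxV x⟩) fun x ↦ ?_
  rw [ideal_mul, Pi.mul_apply, ideal_comap _ f (hU x) (hV x) (hVU x),
    ideal_comap _ f (hU x) (hV x) (hVU x), ideal_comap _ f (hU x) (hV x) (hVU x), ideal_mul,
    Pi.mul_apply, Ideal.map_mul]

theorem comap_prod {ι : Type v} (s : Finset ι) (D : ι → Y.IdealSheafData) (f : X ⟶ Y) :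
    (∏ i ∈ s, D i).comap f = ∏ i ∈ s, (D i).comap f := by
  classical
  induction s using Finset.induction_on with
  | empty => simp
  | insert a s ha ih => rw [Finset.prod_insert ha, Finset.prod_insert ha, comap_mul, ih]

theorem IsLocallyPrincipal.fg {I : X.IdealSheafData} (h : I.IsLocallyPrincipal) {U : X.Opens}
    (hU : IsAffineOpen U) : (I.ideal ⟨U, hU⟩).FG := by
  have H : ∀ x : U, ∃ f : Γ(X, U), x.1 ∈ X.basicOpen f ∧
      ((I.ideal ⟨U, hU⟩).map (X.presheaf.map (homOfLE (X.basicOpen_le f)).op).hom).FG := fun x ↦ by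
    obtain ⟨V, hV, hxV, a, ha⟩ := h x.1
    obtain ⟨f, g, e, hf⟩ := exists_basicOpen_le_affine_inter hU hV x.1 ⟨x.2, hxV⟩
    have e1 : (I.ideal ⟨U, hU⟩).map (X.presheaf.map (homOfLE (X.basicOpen_le f)).op).hom =
        I.ideal ⟨X.basicOpen f, hU.basicOpen f⟩ :=
      I.map_ideal (U := ⟨X.basicOpen f, hU.basicOpen f⟩) (V := ⟨U, hU⟩) (X.basicOpen_le f)
    have e2 := ideal_span_of_le I hV (hU.basicOpen f) (e.le.trans (X.basicOpen_le g)) ha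
    exact ⟨f, hf, (e1.trans e2) ▸ Submodule.fg_span_singleton _⟩
  choose f hxf hf using H
  have hs : Ideal.span (Set.range f) = ⊤ := by
    rw [← hU.self_le_iSup_basicOpen_iff]
    exact fun x hx ↦ Opens.mem_iSup.mpr ⟨⟨_, ⟨x, hx⟩, rfl⟩, hxf ⟨x, hx⟩⟩
  refine Ideal.fg_of_localizationSpan _ hs ?_
  rintro ⟨_, x, rfl⟩
  have := hU.isLocalization_basicOpen (f x)
  have h1 : ((I.ideal ⟨U, hU⟩).map (algebraMap Γ(X, U) Γ(X, X.basicOpen (f x)))).FG := hf x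
  have h2 := h1.map (IsLocalization.algEquiv (Submonoid.powers (f x)) Γ(X, X.basicOpen (f x))
    (Localization.Away (f x))).toAlgHom.toRingHom
  rw [Ideal.map_map] at h2
  convert h2
  exact ((IsLocalization.algEquiv (Submonoid.powers (f x)) Γ(X, X.basicOpen (f x))
    (Localization.Away (f x))).toAlgHom.comp_algebraMap).symm

end AlgebraicGeometry.Scheme.IdealSheafData
theorem IsLocalization.Away.of_subring {B B' : Type u} [CommRing B] [CommRing B'] (φ : B →+* B')
    (s : B) (hloc : letI := φ.toAlgebra; IsLocalization.Away s B') (R : Subring B)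
    (R' : Subring B') (hs : s ∈ R) (h : ∀ x ∈ R, φ x ∈ R')
    (hu : ∃ t ∈ R', φ s * t = 1)
    (hsurj : ∀ y ∈ R', ∃ n : ℕ, ∃ x ∈ R, φ x = φ s ^ n * y) :
    letI := (φ.restrict R R' h).toAlgebra
    IsLocalization.Away (⟨s, hs⟩ : R) R' := by
  let := (φ.restrict R R' h).toAlgebra
  let := φ.toAlgebra
  have hcoe : ∀ x : R, ((algebraMap R R' x : R') : B') = φ x := fun _ ↦ rfl
  obtain ⟨t, ht, hst⟩ := hu
  refine ⟨?_, ?_, ?_⟩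
  · rintro ⟨_, n, rfl⟩
    rw [map_pow]
    refine IsUnit.pow n (.of_mul_eq_one ⟨t, ht⟩ (Subtype.ext hst))
  · rintro ⟨y, hy⟩
    obtain ⟨n, x, hx, e⟩ := hsurj y hy
    refine ⟨(⟨x, hx⟩, ⟨_, n, rfl⟩), Subtype.ext ?_⟩
    simp [hcoe, e, mul_comm]
  · rintro x y e
    have e' : algebraMap B B' x = algebraMap B B' y := congrArg Subtype.val e
    obtain ⟨⟨_, n, rfl⟩, hn⟩ := IsLocalization.exists_of_eq (M := Submonoid.powers s) e'
    exact ⟨⟨_, n, rfl⟩, Subtype.ext (by simpa using hn)⟩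

namespace AlgebraicGeometry.Scheme

/-- Restriction of sections of the structure sheaf, as a ring homomorphism. -/
abbrev resHom {X : Scheme.{u}} {U V : X.Opens} (h : V ≤ U) : Γ(X, U) →+* Γ(X, V) :=
  (X.presheaf.map (homOfLE h).op).hom

theorem resHom_resHom {X : Scheme.{u}} {U V W : X.Opens} (h : V ≤ U) (h' : W ≤ V) (a : Γ(X, U)) :
    resHom h' (resHom h a) = resHom (h'.trans h) a := by
  rw [← CommRingCat.comp_apply, ← Functor.map_comp]
  rfl

/-- A multi-center `{[Y i, D i]}` in `X`: closed subschemes `Y i` and locally principal closed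
subschemes `D i`, all given by their ideal sheaves. -/
structure MultiCenter (X : Scheme.{u}) (ι : Type v) where
  /-- the ideal sheaves of the closed subschemes `Y i` -/
  Y : ι → X.IdealSheafData
  /-- the ideal sheaves of the closed subschemes `D i` -/
  D : ι → X.IdealSheafData
  isLocallyPrincipal : ∀ i, (D i).IsLocallyPrincipal

namespace MultiCenter

variable {X : Scheme.{u}}

section

variable {ι : Type v} [Finite ι] (C : MultiCenter X ι)

/-- The complement of the union of the `D i`. -/
def compl : X.Opens :=
  ⟨⋂ i, ((C.D i).support : Set X)ᶜ,
    isOpen_iInter_of_finite fun i ↦ (C.D i).support.isClosed.isOpen_compl⟩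

/-- The fractions `m / a` with `m` in the ideal `M` of `Y i` and `a` a local generator of the ideal
`J` of `D i`, over an affine open `U`: these are the sections `x` on the complement of the `D i`
such that `J x ⊆ M`. -/
def fractions {U : X.Opens} (hU : IsAffineOpen U) (i : ι) : Set Γ(X, U ⊓ C.compl) :=
  {x | ∀ a ∈ (C.D i).ideal ⟨U, hU⟩, ∃ m ∈ (C.Y i).ideal ⟨U, hU⟩,
    resHom inf_le_left a * x = resHom inf_le_left m}

/-- The dilatation algebra over an affine open `U` with ring of functions `A`: the `A`-subalgebra
of the ring of functions on the complement of the `D i` in `U` (if `D i = V(a i)`, this is the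
localization of `A` at all `a i`) generated by the fractions `m / a i` with `m` in the ideal of
`Y i`. -/
def subring {U : X.Opens} (hU : IsAffineOpen U) : Subring Γ(X, U ⊓ C.compl) :=
  Subring.closure (Set.range (resHom inf_le_left : Γ(X, U) →+* Γ(X, U ⊓ C.compl)) ∪
    ⋃ i, C.fractions hU i)

theorem resHom_mem_subring {U : X.Opens} (hU : IsAffineOpen U) (a : Γ(X, U)) :
    resHom inf_le_left a ∈ C.subring hU :=
  Subring.subset_closure (Or.inl ⟨a, rfl⟩)

theorem fractions_subset_subring {U : X.Opens} (hU : IsAffineOpen U) (i : ι)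
    {x : Γ(X, U ⊓ C.compl)} (hx : x ∈ C.fractions hU i) : x ∈ C.subring hU :=
  Subring.subset_closure (Or.inr (Set.mem_iUnion.mpr ⟨i, hx⟩))

theorem mem_fractions_of_span {U : X.Opens} (hU : IsAffineOpen U) (i : ι)
    (s : Set Γ(X, U)) (hs : (C.D i).ideal ⟨U, hU⟩ ≤ Ideal.span s) {x : Γ(X, U ⊓ C.compl)}
    (h : ∀ a ∈ s, ∃ m ∈ (C.Y i).ideal ⟨U, hU⟩, resHom inf_le_left a * x = resHom inf_le_left m) :
    x ∈ C.fractions hU i := by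
  intro a ha
  replace ha := hs ha
  induction ha using Submodule.span_induction with
  | mem a ha => exact h a ha
  | zero => exact ⟨0, zero_mem _, by simp⟩
  | add a b _ _ h1 h2 =>
    obtain ⟨m, hm, e⟩ := h1
    obtain ⟨m', hm', e'⟩ := h2
    exact ⟨m + m', add_mem hm hm', by rw [map_add, map_add, add_mul, e, e']⟩
  | smul r a _ h1 =>
    obtain ⟨m, hm, e⟩ := h1
    exact ⟨r * m, Ideal.mul_mem_left _ _ hm, by
      rw [smul_eq_mul, map_mul, map_mul, mul_assoc, e]⟩

theorem resHom_mem_subring_of_mem {U V : X.Opens} (hU : IsAffineOpen U) (hV : IsAffineOpen V)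
    (h : V ≤ U) (x : Γ(X, U ⊓ C.compl)) (hx : x ∈ C.subring hU) :
    resHom (inf_le_inf_right _ h) x ∈ C.subring hV := by
  refine (Subring.closure_le (t := (C.subring hV).comap (resHom (inf_le_inf_right _ h)))).mpr ?_ hx
  rintro y (⟨a, rfl⟩ | hy)
  · change resHom _ _ ∈ C.subring hV
    rw [resHom_resHom, ← resHom_resHom h inf_le_left]
    exact C.resHom_mem_subring hV _
  · obtain ⟨i, hy⟩ := Set.mem_iUnion.mp hy
    refine C.fractions_subset_subring hV i ?_
    refine C.mem_fractions_of_span hV i (resHom h '' (C.D i).ideal ⟨U, hU⟩)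
      ((C.D i).map_ideal (U := ⟨V, hV⟩) (V := ⟨U, hU⟩) h).ge ?_
    rintro _ ⟨a, ha, rfl⟩
    obtain ⟨m, hm, e⟩ := hy a ha
    refine ⟨resHom h m, (C.Y i).ideal_le_comap_ideal (U := ⟨V, hV⟩) (V := ⟨U, hU⟩) h hm, ?_⟩
    have := congrArg (resHom (inf_le_inf_right C.compl h)) e
    rw [map_mul, resHom_resHom, resHom_resHom] at this
    rwa [resHom_resHom, resHom_resHom]

/-- The presheaf of dilatation algebras on affine opens. -/
noncomputable def diagram : X.AffineZariskiSiteᵒᵖ ⥤ CommRingCat.{u} where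
  obj U := .of (C.subring U.unop.2)
  map {U V} i := CommRingCat.ofHom ((resHom (inf_le_inf_right _
    (AffineZariskiSite.toOpens_mono i.unop.le))).restrict _ _
      (C.resHom_mem_subring_of_mem U.unop.2 V.unop.2 (AffineZariskiSite.toOpens_mono i.unop.le)))
  map_id U := by
    ext x
    change (X.presheaf.map (𝟙 _)).hom _ = _
    rw [CategoryTheory.Functor.map_id]
    rfl
  map_comp i j := by
    ext x
    exact (resHom_resHom _ _ _).symm

/-- The structure map to the presheaf of dilatation algebras. -/
noncomputable def diagramMap :
    (AffineZariskiSite.toOpensFunctor X).op ⋙ X.presheaf ⟶ C.diagram where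
  app U := CommRingCat.ofHom ((resHom inf_le_left).codRestrict (C.subring U.unop.2)
    (C.resHom_mem_subring U.unop.2))
  naturality {U V} i := by
    ext x
    refine Subtype.ext ?_
    exact (resHom_resHom _ _ _).trans (resHom_resHom _ _ _).symm

theorem mem_compl_iff {x : X} : x ∈ C.compl ↔ ∀ i, x ∉ (C.D i).support := by
  change x ∈ ⋂ i, ((C.D i).support : Set X)ᶜ ↔ _
  simp

theorem le_basicOpen {U : X.Opens} (hU : IsAffineOpen U) {i : ι} {a : Γ(X, U)}
    (ha : (C.D i).ideal ⟨U, hU⟩ = Ideal.span {a}) : U ⊓ C.compl ≤ X.basicOpen a := by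
  rintro x ⟨hxU, hx⟩
  have := C.mem_compl_iff.mp hx i
  rw [IdealSheafData.mem_support_iff_of_mem (U := ⟨U, hU⟩) hxU, ha, zeroLocus_span,
    mem_zeroLocus_iff] at this
  simpa using this

theorem isUnit_resHom {U : X.Opens} (hU : IsAffineOpen U) {i : ι} {a : Γ(X, U)}
    (ha : (C.D i).ideal ⟨U, hU⟩ = Ideal.span {a}) :
    IsUnit (resHom (inf_le_left : U ⊓ C.compl ≤ U) a) := by
  have h1 := (RingedSpace.isUnit_res_basicOpen X.toRingedSpace a).map
    (resHom (C.le_basicOpen hU ha))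
  have h2 := resHom_resHom (X.basicOpen_le a) (C.le_basicOpen hU ha) a
  rw [← h2]
  exact h1

theorem isCompact_inf_compl {U : X.Opens} (hU : IsAffineOpen U) :
    IsCompact ((U ⊓ C.compl : X.Opens) : Set X) := by
  have := Fintype.ofFinite ι
  have h1 : ∀ (s : Finset ι) (x : X), x ∈ (∏ i ∈ s, C.D i).support ↔
      ∃ i ∈ s, x ∈ (C.D i).support := by
    classical
    intro s x
    induction s using Finset.induction_on with
    | empty => simp [← SetLike.mem_coe]
    | insert a s ha ih =>
      rw [Finset.prod_insert ha, IdealSheafData.support_mul, ← SetLike.mem_coe, Closeds.coe_sup,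
        Set.mem_union, SetLike.mem_coe, SetLike.mem_coe, ih]
      simp
  obtain ⟨t, ht⟩ := (IdealSheafData.IsLocallyPrincipal.prod Finset.univ
    fun i _ ↦ C.isLocallyPrincipal i).fg hU
  have : ((U ⊓ C.compl : X.Opens) : Set X) = ⋃ f ∈ t, (X.basicOpen f : Set X) := by
    ext x
    by_cases hx : x ∈ U
    · have h2 := (h1 Finset.univ x).symm.trans
        (IdealSheafData.mem_support_iff_of_mem (U := ⟨U, hU⟩) hx)
      rw [← ht, zeroLocus_span, mem_zeroLocus_iff] at h2
      have : x ∈ C.compl ↔ ∃ f ∈ t, x ∈ X.basicOpen f := by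
        rw [mem_compl_iff]
        simpa using not_congr h2
      simpa [hx] using this
    · have : ∀ f : Γ(X, U), x ∉ X.basicOpen f := fun f hf ↦ hx (X.basicOpen_le f hf)
      simp [hx, this]
  rw [this]
  exact t.finite_toSet.isCompact_biUnion fun f _ ↦ (hU.basicOpen f).isCompact

theorem isLocalization_resHom {U : X.Opens} (hU : IsAffineOpen U) (r : Γ(X, U)) :
    letI := (resHom (inf_le_inf_right C.compl (X.basicOpen_le r))).toAlgebra
    IsLocalization.Away (resHom inf_le_left r : Γ(X, U ⊓ C.compl))
      Γ(X, X.basicOpen r ⊓ C.compl) := by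
  have key : ∀ (V : X.Opens) (hV : V ≤ U ⊓ C.compl)
      (e : V = X.basicOpen (resHom inf_le_left r : Γ(X, U ⊓ C.compl))),
      letI := (resHom hV).toAlgebra
      IsLocalization.Away (resHom inf_le_left r : Γ(X, U ⊓ C.compl)) Γ(X, V) := by
    rintro _ hV rfl
    exact isLocalization_basicOpen_of_qcqs (C.isCompact_inf_compl hU)
      (hU.isQuasiSeparated.of_subset inf_le_left) _
  refine key _ _ ?_
  rw [basicOpen_res]
  refine le_antisymm ?_ ?_
  · exact le_inf (inf_le_inf_right C.compl (X.basicOpen_le r)) inf_le_left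
  · exact le_inf inf_le_right (inf_le_left.trans inf_le_right)

theorem exists_pow_mul_mem {U : X.Opens} (hU : IsAffineOpen U) (r : Γ(X, U)) :
    ∀ y ∈ C.subring (hU.basicOpen r), ∃ n : ℕ, ∃ x ∈ C.subring hU,
      resHom (inf_le_inf_right C.compl (X.basicOpen_le r)) x =
        resHom (inf_le_inf_right C.compl (X.basicOpen_le r)) (resHom inf_le_left r) ^ n * y := by
  intro y hy
  set φ := resHom (inf_le_inf_right C.compl (X.basicOpen_le r)) with hφ
  set s : Γ(X, U ⊓ C.compl) := resHom inf_le_left r with hs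
  have hsR : s ∈ C.subring hU := C.resHom_mem_subring hU r
  let := φ.toAlgebra
  have hloc : IsLocalization.Away s Γ(X, X.basicOpen r ⊓ C.compl) := C.isLocalization_resHom hU r
  have hlocU := hU.isLocalization_basicOpen r
  induction hy using Subring.closure_induction with
  | zero => exact ⟨0, 0, zero_mem _, by simp⟩
  | one => exact ⟨0, 1, one_mem _, by simp⟩
  | neg y _ h =>
    obtain ⟨n, x, hx, e⟩ := h
    exact ⟨n, -x, neg_mem hx, by rw [map_neg, e, mul_neg]⟩
  | add y z _ _ h1 h2 =>
    obtain ⟨n, x, hx, e⟩ := h1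
    obtain ⟨m, w, hw, e'⟩ := h2
    refine ⟨n + m, s ^ m * x + s ^ n * w,
      add_mem (mul_mem (pow_mem hsR _) hx) (mul_mem (pow_mem hsR _) hw), ?_⟩
    rw [map_add, map_mul, map_mul, e, e', map_pow, map_pow]
    ring
  | mul y z _ _ h1 h2 =>
    obtain ⟨n, x, hx, e⟩ := h1
    obtain ⟨m, w, hw, e'⟩ := h2
    refine ⟨n + m, x * w, mul_mem hx hw, ?_⟩
    rw [map_mul, e, e']
    ring
  | mem y hy =>
    obtain (⟨c, rfl⟩ | hy) := hy
    · obtain ⟨n, d, hd⟩ := IsLocalization.Away.surj (S := Γ(X, X.basicOpen r)) r c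
      refine ⟨n, resHom inf_le_left d, C.resHom_mem_subring hU d, ?_⟩
      have hd' : c * resHom (X.basicOpen_le r) r ^ n = resHom (X.basicOpen_le r) d := hd
      rw [hφ, hs, resHom_resHom, resHom_resHom, ← resHom_resHom (X.basicOpen_le r) inf_le_left d,
        ← hd', map_mul, map_pow, resHom_resHom, mul_comm]
    · obtain ⟨i, hy⟩ := Set.mem_iUnion.mp hy
      obtain ⟨n, b, hb⟩ := IsLocalization.Away.surj (S := Γ(X, X.basicOpen r ⊓ C.compl)) s y
      replace hb : y * φ s ^ n = φ b := hb
      obtain ⟨t, ht⟩ := (C.isLocallyPrincipal i).fg hU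
      have H : ∀ g : Γ(X, U), ∃ N : ℕ, g ∈ t → ∃ m ∈ (C.Y i).ideal ⟨U, hU⟩,
          resHom inf_le_left g * (s ^ N * b) = resHom inf_le_left m := by
        intro g
        by_cases hg : g ∈ t
        swap
        · exact ⟨0, fun h ↦ (hg h).elim⟩
        obtain ⟨m', hm', e⟩ := hy (resHom (X.basicOpen_le r) g)
          ((C.D i).ideal_le_comap_ideal (U := ⟨_, hU.basicOpen r⟩) (V := ⟨U, hU⟩)
            (X.basicOpen_le r) (ht.le (Submodule.subset_span hg)))
        have hm2 : m' ∈ ((C.Y i).ideal ⟨U, hU⟩).map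
            (algebraMap Γ(X, U) Γ(X, X.basicOpen r)) :=
          ((C.Y i).map_ideal (U := ⟨_, hU.basicOpen r⟩) (V := ⟨U, hU⟩) (X.basicOpen_le r)).ge hm'
        obtain ⟨⟨⟨m, hm⟩, ⟨_, k, rfl⟩⟩, hk⟩ :=
          (IsLocalization.mem_map_algebraMap_iff (.powers r) Γ(X, X.basicOpen r)).mp hm2
        replace hk : m' * resHom (X.basicOpen_le r) (r ^ k) = resHom (X.basicOpen_le r) m := hk
        have hk2 := congrArg (resHom (inf_le_left : X.basicOpen r ⊓ C.compl ≤ _)) hk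
        rw [map_mul, ← e, map_pow, map_pow, resHom_resHom, resHom_resHom, resHom_resHom] at hk2
        have e3 : ∀ z : Γ(X, U), resHom (inf_le_left.trans (X.basicOpen_le r)) z =
          φ (resHom inf_le_left z) := fun z ↦ (resHom_resHom _ _ _).symm
        have e4 : φ (s ^ k * (resHom inf_le_left g * b)) = φ (s ^ n * resHom inf_le_left m) := by
          rw [map_mul, map_mul, map_mul, ← hb, ← e3 g, ← e3 m, map_pow, map_pow, ← hk2, e3 r]
          ring
        obtain ⟨⟨_, l, rfl⟩, hl⟩ := IsLocalization.exists_of_eq (M := Submonoid.powers s) e4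
        refine ⟨l + k, fun _ ↦ ⟨r ^ l * r ^ n * m, Ideal.mul_mem_left _ _ hm, ?_⟩⟩
        rw [map_mul, map_mul, map_pow, map_pow, ← hs, mul_assoc, ← hl]
        ring
      choose N hN using H
      refine ⟨t.sup N + n, s ^ t.sup N * b, C.fractions_subset_subring hU i
        (C.mem_fractions_of_span hU i t ht.ge fun g hg ↦ ?_), ?_⟩
      · obtain ⟨m, hm, e⟩ := hN g hg
        refine ⟨r ^ (t.sup N - N g) * m, Ideal.mul_mem_left _ _ hm, ?_⟩
        rw [map_mul, map_pow, ← e, ← hs, ← Nat.sub_add_cancel (Finset.le_sup (f := N) hg), pow_add,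
          Nat.add_sub_cancel]
        ring
      · rw [map_mul, ← hb, map_pow]
        ring

theorem exists_inv {U : X.Opens} (hU : IsAffineOpen U) (r : Γ(X, U)) :
    ∃ t ∈ C.subring (hU.basicOpen r), resHom (inf_le_inf_right C.compl (X.basicOpen_le r))
      (resHom inf_le_left r) * t = 1 := by
  have h : IsUnit (resHom (X.basicOpen_le r) r) :=
    RingedSpace.isUnit_res_basicOpen X.toRingedSpace r
  obtain ⟨t, ht⟩ := h.exists_right_inv
  refine ⟨resHom inf_le_left t, C.resHom_mem_subring (hU.basicOpen r) t, ?_⟩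
  rw [resHom_resHom, ← resHom_resHom (X.basicOpen_le r) inf_le_left, ← map_mul, ht, map_one]

theorem coequifibered_diagramMap : C.diagramMap.Coequifibered := by
  refine AffineZariskiSite.coequifibered_iff_forall_isLocalizationAway.mpr fun U r ↦ ?_
  refine IsLocalization.Away.of_subring _ _ (C.isLocalization_resHom U.2 r) _ _
    (C.resHom_mem_subring U.2 r)
    (C.resHom_mem_subring_of_mem U.2 (U.2.basicOpen r) (X.basicOpen_le r)) ?_ (C.exists_pow_mul_mem U.2 r)
  exact C.exists_inv U.2 r

/-- The gluing datum of the dilatation: the spectra of the dilatation algebras. -/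
noncomputable def glueData : (AffineZariskiSite.directedCover X).RelativeGluingData :=
  AffineZariskiSite.relativeGluingData C.coequifibered_diagramMap

instance : (C.glueData.functor ⋙ Scheme.forget).IsLocallyDirected :=
  Cover.RelativeGluingData.instIsLocallyDirectedI₀CompFunctorForgetOfIsThin ..

/-- The dilatation of `X` with multi-center `C`: the relative spectrum over `X` of the dilatation
algebra. -/
noncomputable def dilatation : Scheme.{u} := C.glueData.glued

/-- The dilatation map. -/
noncomputable def toBase : C.dilatation ⟶ X := C.glueData.toBase

/-- The structure map from the functions on an affine open to the dilatation algebra. -/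
noncomputable def algMap {U : X.Opens} (hU : IsAffineOpen U) :
    Γ(X, U) ⟶ CommRingCat.of (C.subring hU) :=
  CommRingCat.ofHom ((resHom inf_le_left).codRestrict (C.subring hU) (C.resHom_mem_subring hU))

/-- The affine chart of the dilatation over an affine open of the base. -/
noncomputable def chart {U : X.Opens} (hU : IsAffineOpen U) :
    Spec (CommRingCat.of (C.subring hU)) ⟶ C.dilatation :=
  C.glueData.cover.f (⟨U, hU⟩ : X.AffineZariskiSite)

instance {U : X.Opens} (hU : IsAffineOpen U) : IsOpenImmersion (C.chart hU) :=
  C.glueData.cover.map_prop (⟨U, hU⟩ : X.AffineZariskiSite)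

theorem chart_toBase {U : X.Opens} (hU : IsAffineOpen U) :
    C.chart hU ≫ C.toBase = Spec.map (C.algMap hU) ≫ hU.fromSpec :=
  colimit.ι_desc _ _

theorem toBase_preimage {U : X.Opens} (hU : IsAffineOpen U) :
    C.toBase ⁻¹ᵁ U = (C.chart hU).opensRange := by
  simpa using! C.glueData.toBase_preimage_eq_opensRange_ι (⟨U, hU⟩ : X.AffineZariskiSite)

theorem exists_chart_lift {U : X.Opens} (hU : IsAffineOpen U) {R : CommRingCat.{u}}
    (g : Spec R ⟶ C.dilatation) (ψ : Γ(X, U) ⟶ R)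
    (h : g ≫ C.toBase = Spec.map ψ ≫ hU.fromSpec) :
    ∃ φ : CommRingCat.of (C.subring hU) ⟶ R,
      g = Spec.map φ ≫ C.chart hU ∧ C.algMap hU ≫ φ = ψ := by
  have hr : Set.range g ⊆ Set.range (C.chart hU) := by
    rintro _ ⟨x, rfl⟩
    have h1 : g x ∈ C.toBase ⁻¹ᵁ U := by
      change C.toBase (g x) ∈ U
      rw [← Scheme.Hom.comp_apply, h, Scheme.Hom.comp_apply, ← SetLike.mem_coe,
        ← hU.range_fromSpec]
      exact ⟨_, rfl⟩
    rw [C.toBase_preimage hU] at h1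
    exact h1
  obtain ⟨φ, hφ⟩ := Spec.map_surjective (IsOpenImmersion.lift (C.chart hU) g hr)
  have h1 : g = Spec.map φ ≫ C.chart hU := by rw [hφ, IsOpenImmersion.lift_fac]
  refine ⟨φ, h1, ?_⟩
  rw [h1, Category.assoc, chart_toBase, ← Category.assoc, ← Spec.map_comp, cancel_mono] at h
  exact Spec.map_injective h

theorem ringHom_unique {U : X.Opens} (hU : IsAffineOpen U) {R : Type u} [CommRing R]
    {a : ι → Γ(X, U)} (ha : ∀ i, (C.D i).ideal ⟨U, hU⟩ = Ideal.span {a i})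
    (φ₁ φ₂ : C.subring hU →+* R)
    (h : φ₁.comp (C.algMap hU).hom = φ₂.comp (C.algMap hU).hom)
    (hreg : ∀ i, φ₁ ((C.algMap hU).hom (a i)) ∈ nonZeroDivisors R) : φ₁ = φ₂ := by
  ext ⟨x, hx⟩
  have h' : ∀ c, φ₁ ((C.algMap hU).hom c) = φ₂ ((C.algMap hU).hom c) := fun c ↦ congr($h c)
  induction hx using Subring.closure_induction with
  | zero => exact (map_zero φ₁).trans (map_zero φ₂).symm
  | one => exact (map_one φ₁).trans (map_one φ₂).symm
  | neg x hx e =>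
    have := congrArg Neg.neg e
    rwa [← map_neg, ← map_neg] at this
  | add x y hx hy e e' =>
    have := congr($e + $e')
    rwa [← map_add, ← map_add] at this
  | mul x y hx hy e e' =>
    have := congr($e * $e')
    rwa [← map_mul, ← map_mul] at this
  | mem x hx =>
    obtain (⟨c, rfl⟩ | hx) := hx
    · exact h' c
    · obtain ⟨i, hx⟩ := Set.mem_iUnion.mp hx
      obtain ⟨m, -, e⟩ := hx (a i) ((ha i) ▸ Ideal.mem_span_singleton_self _)
      have e' : (C.algMap hU).hom (a i) * ⟨x, C.fractions_subset_subring hU i hx⟩ =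
        (C.algMap hU).hom m := Subtype.ext e
      have e1 := congrArg φ₁ e'
      have e2 := congrArg φ₂ e'
      rw [map_mul] at e1 e2
      rw [← h', ← h', ← e1] at e2
      exact (mul_cancel_left_mem_nonZeroDivisors (hreg i)).mp e2.symm

theorem inf_compl_eq_basicOpen [Fintype ι] {U : X.Opens} (hU : IsAffineOpen U) {a : ι → Γ(X, U)}
    (ha : ∀ i, (C.D i).ideal ⟨U, hU⟩ = Ideal.span {a i}) :
    U ⊓ C.compl = X.basicOpen (∏ i, a i) := by
  classical
  have key : ∀ (s : Finset ι) (x : X), x ∈ U →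
      (x ∈ X.basicOpen (∏ i ∈ s, a i) ↔ ∀ i ∈ s, x ∈ X.basicOpen (a i)) := by
    intro s x hx
    induction s using Finset.induction_on with
    | empty => simp [Scheme.basicOpen_of_isUnit, hx]
    | insert i s hi ih =>
      rw [Finset.prod_insert hi, Scheme.basicOpen_mul]
      simp [ih]
  ext x
  simp only [SetLike.mem_coe]
  constructor
  · intro hx
    exact (key _ x hx.1).mpr fun i _ ↦ C.le_basicOpen hU (ha i) hx
  · intro hx
    have hxU := X.basicOpen_le _ hx
    refine ⟨hxU, C.mem_compl_iff.mpr fun i ↦ ?_⟩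
    rw [IdealSheafData.mem_support_iff_of_mem (U := ⟨U, hU⟩) hxU, ha, zeroLocus_span,
      mem_zeroLocus_iff]
    simpa using (key _ x hxU).mp hx i (Finset.mem_univ i)

theorem exists_ringHom {U : X.Opens} (hU : IsAffineOpen U) {R : Type u} [CommRing R]
    {a : ι → Γ(X, U)} (ha : ∀ i, (C.D i).ideal ⟨U, hU⟩ = Ideal.span {a i})
    (ψ : Γ(X, U) →+* R) (hreg : ∀ i, ψ (a i) ∈ nonZeroDivisors R)
    (hdvd : ∀ i, ∀ m ∈ (C.Y i).ideal ⟨U, hU⟩, ψ (a i) ∣ ψ m) :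
    ∃ φ : C.subring hU →+* R, φ.comp (C.algMap hU).hom = ψ := by
  have := Fintype.ofFinite ι
  let b := ∏ i, a i
  let := (resHom (inf_le_left : U ⊓ C.compl ≤ U)).toAlgebra
  have hloc : IsLocalization.Away b Γ(X, U ⊓ C.compl) := by
    have key : ∀ (V : X.Opens) (hV : V ≤ U) (e : V = X.basicOpen b),
        letI := (resHom hV).toAlgebra
        IsLocalization.Away b Γ(X, V) := by
      rintro _ hV rfl
      exact hU.isLocalization_basicOpen b
    exact key _ _ (C.inf_compl_eq_basicOpen hU ha)
  have hb : ψ b ∈ nonZeroDivisors R := by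
    rw [map_prod]
    exact prod_mem fun i _ ↦ hreg i
  have hinj : Function.Injective (algebraMap R (Localization.Away (ψ b))) :=
    IsLocalization.injective _ (Submonoid.powers_le.mpr hb)
  have hunit : IsUnit ((algebraMap R (Localization.Away (ψ b))).comp ψ b) :=
    IsLocalization.Away.algebraMap_isUnit (ψ b)
  let θ : Γ(X, U ⊓ C.compl) →+* Localization.Away (ψ b) := IsLocalization.Away.lift b hunit
  have hθ : ∀ c, θ (resHom inf_le_left c) = algebraMap R _ (ψ c) := fun c ↦
    IsLocalization.Away.lift_eq b hunit c
  have hrange : ∀ x ∈ C.subring hU, θ x ∈ (algebraMap R (Localization.Away (ψ b))).range := by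
    intro x hx
    refine (Subring.closure_le (t := (algebraMap R (Localization.Away (ψ b))).range.comap θ)).mpr
      ?_ hx
    rintro y (⟨c, rfl⟩ | hy)
    · exact ⟨ψ c, (hθ c).symm⟩
    · obtain ⟨i, hy⟩ := Set.mem_iUnion.mp hy
      obtain ⟨m, hm, e⟩ := hy (a i) ((ha i) ▸ Ideal.mem_span_singleton_self _)
      obtain ⟨r, hr⟩ := hdvd i m hm
      refine ⟨r, ?_⟩
      have e' := congrArg θ e
      rw [map_mul, hθ, hθ, hr, map_mul] at e'
      have hu : IsUnit (algebraMap R (Localization.Away (ψ b)) (ψ (a i))) := by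
        rw [← hθ]
        exact (C.isUnit_resHom hU (ha i)).map θ
      exact (hu.mul_left_cancel e').symm
  let e := (RingEquiv.ofBijective (algebraMap R (Localization.Away (ψ b))).rangeRestrict
    ⟨fun x y h ↦ hinj (congrArg Subtype.val h), RingHom.rangeRestrict_surjective _⟩)
  refine ⟨e.symm.toRingHom.comp (θ.restrict _ _ hrange), ?_⟩
  ext c
  change e.symm _ = _
  rw [RingEquiv.symm_apply_eq]
  exact Subtype.ext (hθ c)

theorem hom_ext {T : Scheme.{u}} (g₁ g₂ : T ⟶ C.dilatation) (h : g₁ ≫ C.toBase = g₂ ≫ C.toBase)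
    (hreg : ∀ i, ((C.D i).comap (g₁ ≫ C.toBase)).IsCartier) : g₁ = g₂ := by
  have H : ∀ t : T, ∃ V : T.Opens, t ∈ V ∧ V.ι ≫ g₁ = V.ι ≫ g₂ := fun t ↦ by
    obtain ⟨U, hU, hxU, -, ha⟩ := IdealSheafData.exists_principal C.isLocallyPrincipal
      ((g₁ ≫ C.toBase) t) ⊤ trivial
    choose a ha using ha
    obtain ⟨V, hV, htV, hVU⟩ := IdealSheafData.exists_affine_le (g₁ ≫ C.toBase) t U hxU
    refine ⟨V, htV, ?_⟩
    rw [← cancel_epi hV.isoSpec.inv]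
    have hψ : Spec.map ((g₁ ≫ C.toBase).appLE U V hVU) ≫ hU.fromSpec =
      hV.fromSpec ≫ g₁ ≫ C.toBase := IsAffineOpen.SpecMap_appLE_fromSpec _ hU hV hVU
    obtain ⟨φ₁, e₁, h₁⟩ := C.exists_chart_lift hU (hV.fromSpec ≫ g₁)
      ((g₁ ≫ C.toBase).appLE U V hVU) (by rw [hψ, Category.assoc])
    obtain ⟨φ₂, e₂, h₂⟩ := C.exists_chart_lift hU (hV.fromSpec ≫ g₂)
      ((g₁ ≫ C.toBase).appLE U V hVU) (by rw [hψ, Category.assoc, h])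
    have : φ₁.hom = φ₂.hom := by
      refine C.ringHom_unique hU ha _ _ ?_ fun i ↦ ?_
      · rw [← CommRingCat.hom_comp, ← CommRingCat.hom_comp, h₁, h₂]
      · rw [← RingHom.comp_apply, ← CommRingCat.hom_comp, h₁]
        exact (hreg i).mem_nonZeroDivisors hV
          (IdealSheafData.ideal_comap_span _ (g₁ ≫ C.toBase) hU hV hVU (ha i))
    rw [CommRingCat.hom_ext this, ← e₂] at e₁
    rw [← Category.assoc, ← Category.assoc, IsAffineOpen.isoSpec_inv_ι]
    exact e₁
  choose V htV hV using H
  exact (T.openCoverOfIsOpenCover V (top_le_iff.mp fun x _ ↦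
    Opens.mem_iSup.mpr ⟨x, htV x⟩)).hom_ext _ _ hV

/-- The universal property of dilatations. -/
theorem existsUnique_lift {T : Scheme.{u}} (f : T ⟶ X)
    (hreg : ∀ i, ((C.D i).comap f).IsCartier)
    (hle : ∀ i, (C.Y i).comap f ≤ (C.D i).comap f) :
    ∃! g : T ⟶ C.dilatation, g ≫ C.toBase = f := by
  have H : ∀ t : T, ∃ V : T.Opens, t ∈ V ∧ ∃ g : V.toScheme ⟶ C.dilatation,
      g ≫ C.toBase = V.ι ≫ f := fun t ↦ by
    obtain ⟨U, hU, hxU, -, ha⟩ := IdealSheafData.exists_principal C.isLocallyPrincipal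
      (f t) ⊤ trivial
    choose a ha using ha
    obtain ⟨V, hV, htV, hVU⟩ := IdealSheafData.exists_affine_le f t U hxU
    obtain ⟨φ, hφ⟩ := C.exists_ringHom hU ha (f.appLE U V hVU).hom
      (fun i ↦ (hreg i).mem_nonZeroDivisors hV (IdealSheafData.ideal_comap_span _ f hU hV hVU (ha i)))
      (fun i m hm ↦ by
        have h1 := hle i ⟨V, hV⟩
        rw [IdealSheafData.ideal_comap_span _ f hU hV hVU (ha i),
          IdealSheafData.ideal_comap _ f hU hV hVU] at h1
        exact Ideal.mem_span_singleton.mp (h1 (Ideal.mem_map_of_mem _ hm)))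
    refine ⟨V, htV, hV.isoSpec.hom ≫ Spec.map (CommRingCat.ofHom φ) ≫ C.chart hU, ?_⟩
    have h2 : C.algMap hU ≫ CommRingCat.ofHom φ = f.appLE U V hVU := CommRingCat.hom_ext hφ
    rw [Category.assoc, Category.assoc, chart_toBase, ← Spec.map_comp_assoc, h2,
      IsAffineOpen.SpecMap_appLE_fromSpec f hU hV hVU]
    rw [← IsAffineOpen.isoSpec_inv_ι, Category.assoc, Iso.hom_inv_id_assoc]
  choose V htV g hg using H
  let 𝒰 := T.openCoverOfIsOpenCover V (top_le_iff.mp fun x _ ↦ Opens.mem_iSup.mpr ⟨x, htV x⟩)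
  have hcompat : ∀ x y : T, pullback.fst (V x).ι (V y).ι ≫ g x =
      pullback.snd (V x).ι (V y).ι ≫ g y := fun x y ↦ by
    refine C.hom_ext _ _ ?_ fun i ↦ ?_
    · rw [Category.assoc, Category.assoc, hg, hg, pullback.condition_assoc]
    · rw [Category.assoc, hg, ← Category.assoc, IdealSheafData.comap_comp]
      exact (hreg i).comap_of_isOpenImmersion _
  have key : ∀ t, (V t).ι ≫ 𝒰.glueMorphisms g hcompat = g t :=
    fun t ↦ 𝒰.ι_glueMorphisms g hcompat t
  have hG : 𝒰.glueMorphisms g hcompat ≫ C.toBase = f :=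
    𝒰.hom_ext _ _ fun t ↦ (Category.assoc _ _ _).symm.trans
      ((congrArg (· ≫ C.toBase) (key t)).trans (hg t))
  refine ⟨𝒰.glueMorphisms g hcompat, hG, fun g' hg' ↦ C.hom_ext _ _ (hg'.trans hG.symm) ?_⟩
  rw [hg']
  exact hreg

/-- The coordinate ring of the chart of the dilatation over an affine open. -/
noncomputable def chartIso {U : X.Opens} (hU : IsAffineOpen U) :
    CommRingCat.of (C.subring hU) ≅ Γ(C.dilatation, (C.chart hU) ''ᵁ ⊤) :=
  (Scheme.ΓSpecIso _).symm ≪≫ ((C.chart hU).appIso ⊤).symm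

theorem isAffineOpen_chart {U : X.Opens} (hU : IsAffineOpen U) :
    IsAffineOpen ((C.chart hU) ''ᵁ ⊤) :=
  (isAffineOpen_top _).image_of_isOpenImmersion _

theorem chart_le {U : X.Opens} (hU : IsAffineOpen U) :
    (C.chart hU) ''ᵁ ⊤ ≤ C.toBase ⁻¹ᵁ U := by
  rw [C.toBase_preimage hU]
  rintro _ ⟨x, -, rfl⟩
  exact ⟨x, rfl⟩

theorem exists_mem_chart (p : C.dilatation) {U : X.Opens} (hU : IsAffineOpen U)
    (hp : C.toBase p ∈ U) : p ∈ (C.chart hU) ''ᵁ ⊤ := by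
  have h : p ∈ C.toBase ⁻¹ᵁ U := hp
  rw [C.toBase_preimage hU] at h
  obtain ⟨x, rfl⟩ := h
  exact ⟨x, trivial, rfl⟩

theorem toBase_appLE {U : X.Opens} (hU : IsAffineOpen U) :
    C.toBase.appLE U ((C.chart hU) ''ᵁ ⊤) (C.chart_le hU) = C.algMap hU ≫ (C.chartIso hU).hom := by
  have h1 : C.toBase.appLE U ((C.chart hU) ''ᵁ ⊤) (C.chart_le hU) ≫ ((C.chart hU).appIso ⊤).hom =
      C.algMap hU ≫ (Scheme.ΓSpecIso _).inv := by
    rw [Scheme.Hom.appIso_hom', Scheme.Hom.appLE_comp_appLE]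
    have key : ∀ (f : Spec (CommRingCat.of (C.subring hU)) ⟶ X)
        (_ : f = Spec.map (C.algMap hU) ≫ hU.fromSpec) (h : ⊤ ≤ f ⁻¹ᵁ U),
        f.appLE U ⊤ h = C.algMap hU ≫ (Scheme.ΓSpecIso _).inv := by
      rintro _ rfl h
      have h2 : (⊤ : (Spec Γ(X, U)).Opens) ≤ hU.fromSpec ⁻¹ᵁ U := by simp
      rw [Scheme.ΓSpecIso_inv_naturality, ← Scheme.Hom.appLE_comp_appLE (Spec.map (C.algMap hU))
        hU.fromSpec U ⊤ ⊤ h2 (by simp)]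
      congr 1
      · rw [Scheme.Hom.appLE, IsAffineOpen.fromSpec_app_self, Category.assoc, ← Functor.map_comp]
        have : ∀ (g : Opposite.op (⊤ : (Spec Γ(X, U)).Opens) ⟶ Opposite.op ⊤),
            (Spec Γ(X, U)).presheaf.map g = 𝟙 _ := fun g ↦ by
          rw [Subsingleton.elim g (𝟙 _), CategoryTheory.Functor.map_id]
        rw [this, Category.comp_id]
    exact key _ (C.chart_toBase hU) _
  rw [chartIso, Iso.trans_hom, Iso.symm_hom, Iso.symm_hom, ← Category.assoc, ← h1, Category.assoc,
    Iso.hom_inv_id, Category.comp_id]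

theorem ideal_comap_toBase (I : X.IdealSheafData) {U : X.Opens} (hU : IsAffineOpen U) :
    (I.comap C.toBase).ideal ⟨(C.chart hU) ''ᵁ ⊤, C.isAffineOpen_chart hU⟩ =
      (I.ideal ⟨U, hU⟩).map (C.algMap hU ≫ (C.chartIso hU).hom).hom := by
  rw [IdealSheafData.ideal_comap I C.toBase hU (C.isAffineOpen_chart hU) (C.chart_le hU),
    toBase_appLE]

theorem mem_nonZeroDivisors_algMap {U : X.Opens} (hU : IsAffineOpen U) (a : Γ(X, U))
    (ha : resHom inf_le_left a ∈ nonZeroDivisors Γ(X, U ⊓ C.compl)) :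
    (C.algMap hU ≫ (C.chartIso hU).hom).hom a ∈
      nonZeroDivisors Γ(C.dilatation, (C.chart hU) ''ᵁ ⊤) := by
  have h1 : (C.algMap hU).hom a ∈ nonZeroDivisors (C.subring hU) := by
    rw [mem_nonZeroDivisors_iff_right] at ha ⊢
    exact fun x hx ↦ Subtype.ext (ha x.1 (congrArg Subtype.val hx))
  exact (MulEquivClass.map_nonZeroDivisors
    (C.chartIso hU).commRingCatIsoToRingEquiv).le ⟨_, h1, rfl⟩

/-- Cartier divisors pull back to Cartier divisors along a dilatation map. -/
theorem isCartier_comap_toBase {I : X.IdealSheafData} (hI : I.IsCartier) :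
    (I.comap C.toBase).IsCartier := fun p ↦ by
  obtain ⟨U, hU, hx, a, -, ha⟩ := hI (C.toBase p)
  refine ⟨_, C.isAffineOpen_chart hU, C.exists_mem_chart p hU hx, _,
    C.mem_nonZeroDivisors_algMap hU a (hI.mem_nonZeroDivisors_of_le hU ha inf_le_left), ?_⟩
  rw [ideal_comap_toBase, ha, Ideal.map_span, Set.image_singleton]

/-- The divisors of the multi-center pull back to Cartier divisors on the dilatation. -/
theorem isCartier_comap_D (i : ι) : ((C.D i).comap C.toBase).IsCartier := fun p ↦ by
  obtain ⟨U, hU, hx, a, ha⟩ := C.isLocallyPrincipal i (C.toBase p)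
  refine ⟨_, C.isAffineOpen_chart hU, C.exists_mem_chart p hU hx, _,
    C.mem_nonZeroDivisors_algMap hU a (C.isUnit_resHom hU ha).mem_nonZeroDivisors, ?_⟩
  rw [ideal_comap_toBase, ha, Ideal.map_span, Set.image_singleton]

/-- On the dilatation, the divisor `D i` is contained in the pullback of the center `Y i`. -/
theorem comap_Y_le (i : ι) : (C.Y i).comap C.toBase ≤ (C.D i).comap C.toBase := by
  choose U hU hx a ha using fun p ↦ C.isLocallyPrincipal i (C.toBase p)
  refine IdealSheafData.le_of_iSup_eq_top (fun p ↦ ⟨_, C.isAffineOpen_chart (hU p)⟩)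
    (top_le_iff.mp fun p _ ↦ Opens.mem_iSup.mpr ⟨p, C.exists_mem_chart p (hU p) (hx p)⟩) fun p ↦ ?_
  rw [ideal_comap_toBase, ideal_comap_toBase, Ideal.map_le_iff_le_comap]
  intro m hm
  obtain ⟨t, ht⟩ := (C.isUnit_resHom (hU p) (ha p)).exists_right_inv
  have hmem : resHom inf_le_left m * t ∈ C.fractions (hU p) i := by
    refine C.mem_fractions_of_span (hU p) i {a p} (ha p).le ?_
    rintro _ rfl
    exact ⟨m, hm, by rw [mul_left_comm, ht, mul_one]⟩
  have e : (C.algMap (hU p)).hom m = (C.algMap (hU p)).hom (a p) *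
      ⟨_, C.fractions_subset_subring (hU p) i hmem⟩ :=
    Subtype.ext (by
      change resHom inf_le_left m = resHom inf_le_left (a p) * (resHom inf_le_left m * t)
      rw [mul_left_comm, ht, mul_one])
  rw [Ideal.mem_comap, CommRingCat.hom_comp, RingHom.comp_apply, e, map_mul]
  refine Ideal.mul_mem_right _ _ (Ideal.mem_map_of_mem
    (C.algMap (hU p) ≫ (C.chartIso (hU p)).hom).hom ?_)
  rw [ha]
  exact Ideal.mem_span_singleton_self _

theorem exists_fractions_lift {X' : Scheme.{u}} {ι' : Type v} [Finite ι'] (C' : MultiCenter X' ι')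
    (i : X' ⟶ X) {U : X.Opens} (hU : IsAffineOpen U) (hU' : IsAffineOpen (i ⁻¹ᵁ U))
    (hi : Function.Surjective (i.app U)) {j : ι} {j' : ι'}
    (hD : C'.D j' = (C.D j).comap i) (hY : C'.Y j' = (C.Y j).comap i) {a : Γ(X, U)}
    (ha : (C.D j).ideal ⟨U, hU⟩ = Ideal.span {a}) (φ : C.subring hU →+* C'.subring hU')
    (hφ : ∀ c, φ ((C.algMap hU).hom c) = (C'.algMap hU').hom ((i.app U).hom c))
    (x : Γ(X', i ⁻¹ᵁ U ⊓ C'.compl)) (hx : x ∈ C'.fractions hU' j') :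
    ∃ y, (φ y : Γ(X', i ⁻¹ᵁ U ⊓ C'.compl)) = x := by
  have e : i.appLE U (i ⁻¹ᵁ U) le_rfl = i.app U := (Scheme.Hom.app_eq_appLE (f := i)).symm
  have ha' : (C'.D j').ideal ⟨_, hU'⟩ = Ideal.span {(i.app U).hom a} := by
    rw [hD, IdealSheafData.ideal_comap_span _ i hU hU' le_rfl ha, e]
  obtain ⟨m', hm', e'⟩ := hx ((i.app U).hom a) (ha' ▸ Ideal.mem_span_singleton_self _)
  rw [hY, IdealSheafData.ideal_comap _ i hU hU' le_rfl, e,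
    Ideal.mem_map_iff_of_surjective _ hi] at hm'
  obtain ⟨m, hm, rfl⟩ := hm'
  obtain ⟨t, ht⟩ := (C.isUnit_resHom hU ha).exists_right_inv
  have hmem : resHom inf_le_left m * t ∈ C.fractions hU j := by
    refine C.mem_fractions_of_span hU j {a} ha.le ?_
    rintro _ rfl
    exact ⟨m, hm, by rw [mul_left_comm, ht, mul_one]⟩
  let y : C.subring hU := ⟨_, C.fractions_subset_subring hU j hmem⟩
  have hy : (C.algMap hU).hom a * y = (C.algMap hU).hom m := Subtype.ext (by
    change resHom inf_le_left a * (resHom inf_le_left m * t) = resHom inf_le_left m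
    rw [mul_left_comm, ht, mul_one])
  refine ⟨y, (C'.isUnit_resHom hU' ha').mul_left_cancel ?_⟩
  rw [e']
  have h1 := congrArg φ hy
  rw [map_mul, hφ, hφ] at h1
  exact congrArg Subtype.val h1

/-- A morphism of dilatations over a closed immersion is a closed immersion if the multi-center of
the source is the pullback of a part of the multi-center of the target. -/
theorem isClosedImmersion_of_comap {X' : Scheme.{u}} {ι' : Type v} [Finite ι']
    (C' : MultiCenter X' ι') (i : X' ⟶ X) [IsClosedImmersion i] (σ : ι' → ι)
    (hD : ∀ j, C'.D j = (C.D (σ j)).comap i) (hY : ∀ j, C'.Y j = (C.Y (σ j)).comap i)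
    (F : C'.dilatation ⟶ C.dilatation) (hF : F ≫ C.toBase = C'.toBase ≫ i) :
    IsClosedImmersion F := by
  choose U hU hxU _ ha using fun p : C.dilatation ↦
    IdealSheafData.exists_principal C.isLocallyPrincipal (C.toBase p) ⊤ trivial
  refine IsZariskiLocalAtTarget.of_forall_exists_morphismRestrict fun p ↦ ?_
  refine ⟨(C.chart (hU p)).opensRange, ?_, ?_⟩
  · have := C.exists_mem_chart p (hU p) (hxU p)
    rwa [Scheme.Hom.image_top_eq_opensRange] at this
  have hU' : IsAffineOpen (i ⁻¹ᵁ U p) := (hU p).preimage i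
  have hi : Function.Surjective (i.app (U p)) := i.app_surjective (U p) (hU p)
  obtain ⟨φ, h1, h2⟩ := C.exists_chart_lift (hU p) (C'.chart hU' ≫ F)
    (i.app (U p) ≫ C'.algMap hU') (by
      rw [Category.assoc, hF, ← Category.assoc, chart_toBase, Spec.map_comp, Category.assoc,
        Category.assoc]
      congr 1
      have := IsAffineOpen.SpecMap_appLE_fromSpec i (hU p) hU' le_rfl
      rw [← this, Scheme.Hom.app_eq_appLE])
  have hsurj : Function.Surjective φ := by
    choose a ha using ha p
    rintro ⟨x, hx⟩
    induction hx using Subring.closure_induction with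
    | zero => exact ⟨0, map_zero φ.hom⟩
    | one => exact ⟨1, map_one φ.hom⟩
    | neg x hx h =>
      obtain ⟨y, hy⟩ := h
      exact ⟨-y, (map_neg φ.hom y).trans (congrArg Neg.neg hy)⟩
    | add x x' hx hx' h h' =>
      obtain ⟨y, hy⟩ := h
      obtain ⟨y', hy'⟩ := h'
      exact ⟨y + y', (map_add φ.hom y y').trans (congrArg₂ (· + ·) hy hy')⟩
    | mul x x' hx hx' h h' =>
      obtain ⟨y, hy⟩ := h
      obtain ⟨y', hy'⟩ := h'
      exact ⟨y * y', (map_mul φ.hom y y').trans (congrArg₂ (· * ·) hy hy')⟩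
    | mem x hx =>
      obtain (⟨c, rfl⟩ | hx) := hx
      · obtain ⟨d, rfl⟩ := hi c
        exact ⟨(C.algMap (hU p)).hom d, congrArg (fun f ↦ f.hom d) h2⟩
      · obtain ⟨j, hx⟩ := Set.mem_iUnion.mp hx
        obtain ⟨y, hy⟩ := C.exists_fractions_lift C' i (hU p) hU' hi (hD j) (hY j) (ha (σ j))
          φ.hom (fun c ↦ congrArg (fun f ↦ f.hom c) h2) x hx
        exact ⟨y, Subtype.ext hy⟩
  have hpb : IsPullback (Spec.map φ) (C'.chart hU') (C.chart (hU p)) F := by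
    refine IsOpenImmersion.isPullback _ _ _ _ h1 ?_
    rw [← C.toBase_preimage (hU p), ← C'.toBase_preimage hU', ← Scheme.Hom.comp_preimage, hF,
      Scheme.Hom.comp_preimage]
  have hc : IsClosedImmersion (pullback.snd F (C.chart (hU p))) := by
    have h3 : IsClosedImmersion (Spec.map φ) := IsClosedImmersion.spec_of_surjective φ hsurj
    rw [← MorphismProperty.cancel_left_of_respectsIso @IsClosedImmersion
      hpb.flip.isoPullback.hom, IsPullback.isoPullback_hom_snd]
    exact h3
  exact (MorphismProperty.arrow_mk_iso_iff @IsClosedImmersion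
    (morphismRestrictOpensRange F (C.chart (hU p)))).mpr hc

end

/-! ### Deformation spaces -/

/-- The multi-center `{[Y i, ∑_{j ≥ i} D j]}`; the sum of closed subschemes corresponds to the
product of ideals. -/
noncomputable def deformationCenter {ι : Type v} [LinearOrder ι] [Fintype ι]
    (C : MultiCenter X ι) :
    MultiCenter X ι where
  Y := C.Y
  D i := ∏ j : ι with i ≤ j, C.D j
  isLocallyPrincipal _ := .prod _ fun j _ ↦ C.isLocallyPrincipal j

/-- The deformation space of `(Y i, D i)`: the dilatation of `X` with multi-center
`{[Y i, ∑_{j ≥ i} D j]}`. -/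
noncomputable abbrev deformationSpace {ι : Type v} [LinearOrder ι] [Fintype ι]
    (C : MultiCenter X ι) :
    Scheme.{u} :=
  C.deformationCenter.dilatation

/-- The structure map of the deformation space. -/
noncomputable abbrev deformationMap {ι : Type v} [LinearOrder ι] [Fintype ι]
    (C : MultiCenter X ι) :
    C.deformationSpace ⟶ X :=
  C.deformationCenter.toBase

/-- The restriction of a family `(Y i, D i)` to a finite set of indices. -/
def restrict {I : Type v} (C : MultiCenter X I) (S : Finset I) : MultiCenter X S where
  Y s := C.Y s
  D s := C.D s
  isLocallyPrincipal s := C.isLocallyPrincipal s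

/-- The pullback of a family `(Y i, D i)` along a morphism. -/
noncomputable def comap {I : Type v} (C : MultiCenter X I) {X' : Scheme.{u}} (f : X' ⟶ X) :
    MultiCenter X' I where
  Y i := (C.Y i).comap f
  D i := (C.D i).comap f
  isLocallyPrincipal i := (C.isLocallyPrincipal i).comap f

theorem deformationCenter_restrict_D {I : Type v} [LinearOrder I] (C : MultiCenter X I)
    (S : Finset I) (s : S) :
    (C.restrict S).deformationCenter.D s = ∏ j ∈ S with s.1 ≤ j, C.D j := by
  change ∏ j : S with s ≤ j, C.D j.1 = _
  rw [Finset.prod_filter, Finset.prod_filter,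
    ← Finset.prod_coe_sort S (fun j ↦ if s.1 ≤ j then C.D j else 1)]
  rfl

theorem deformationCenter_comap_D {ι : Type v} [LinearOrder ι] [Fintype ι] (C : MultiCenter X ι)
    {X' : Scheme.{u}} (f : X' ⟶ X) (i : ι) :
    (C.comap f).deformationCenter.D i = (C.deformationCenter.D i).comap f :=
  (IdealSheafData.comap_prod _ _ f).symm

end MultiCenter

/-- A deformation datum on `X` indexed by `I`: closed subschemes `Y i`, decreasing in `i` (so the
ideal sheaves are increasing), and locally principal closed subschemes `D i`. -/
structure DeformationDatum (X : Scheme.{u}) (I : Type v) [LinearOrder I] extends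
    MultiCenter X I where
  monotone_Y : Monotone Y

namespace DeformationDatum

variable {X : Scheme.{u}} {I : Type v} [LinearOrder I] (𝒟 : DeformationDatum X I)

/-- The intersection `Y i ∩ D j` is a Cartier divisor in `Y i` for all `i`, `j`. -/
def IsRegular : Prop :=
  ∀ i j, ((𝒟.D j).comap (𝒟.Y i).subschemeι).IsCartier

/-- The deformation space of the data `(Y s, D s)` with `s ∈ S`. -/
noncomputable abbrev partialSpace (S : Finset I) : Scheme.{u} :=
  (𝒟.restrict S).deformationSpace

/-- The structure map of `partialSpace`. -/
noncomputable abbrev partialMap (S : Finset I) : 𝒟.partialSpace S ⟶ X :=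
  (𝒟.restrict S).deformationMap

/-- The data `(Y s, D s ∩ Y k)` on `Y k`, with `s ∈ S` and `s > k`. -/
noncomputable abbrev pieceCenter (S : Finset I) (k : I) :
    MultiCenter (𝒟.Y k).subscheme (S.filter (k < ·)) :=
  (𝒟.restrict (S.filter (k < ·))).comap (𝒟.Y k).subschemeι

/-- The deformation space over `Y k` of the data `(Y s, D s ∩ Y k)` with `s ∈ S` and `s > k`. -/
noncomputable abbrev piece (S : Finset I) (k : I) : Scheme.{u} :=
  (𝒟.pieceCenter S k).deformationSpace

/-- The structure map of `piece` as a scheme over `X`. -/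
noncomputable abbrev pieceMap (S : Finset I) (k : I) : 𝒟.piece S k ⟶ X :=
  (𝒟.pieceCenter S k).deformationMap ≫ (𝒟.Y k).subschemeι

theorem pieceCenter_D (S : Finset I) (k : I) (s : S.filter (k < ·))
    (hs : s.1 ∈ S) : (𝒟.pieceCenter S k).deformationCenter.D s =
      ((𝒟.restrict S).deformationCenter.D ⟨s, hs⟩).comap (𝒟.Y k).subschemeι := by
  rw [MultiCenter.deformationCenter_comap_D, MultiCenter.deformationCenter_restrict_D,
    MultiCenter.deformationCenter_restrict_D, Finset.filter_filter]
  have hk : k < s.1 := (Finset.mem_filter.mp s.2).2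
  refine congrArg (fun t ↦ (∏ j ∈ t, 𝒟.D j).comap (𝒟.Y k).subschemeι) ?_
  exact Finset.filter_congr fun j _ ↦ ⟨fun h ↦ h.2, fun h ↦ ⟨hk.trans_le h, h⟩⟩

/-- There is a unique `X`-morphism from the deformation space over `Y k` of the data with `s ∈ S`,
`s > k`, to the deformation space over `X` of the data with `s ∈ S`. -/
theorem existsUnique_pieceHom (h𝒟 : 𝒟.IsRegular) (S : Finset I) (k : I) :
    ∃! F : 𝒟.piece S k ⟶ 𝒟.partialSpace S, F ≫ 𝒟.partialMap S = 𝒟.pieceMap S k := by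
  refine MultiCenter.existsUnique_lift _ _ (fun s ↦ ?_) fun s ↦ ?_
  · rw [IdealSheafData.comap_comp]
    refine MultiCenter.isCartier_comap_toBase _ ?_
    rw [MultiCenter.deformationCenter_restrict_D, IdealSheafData.comap_prod]
    exact .prod _ fun j _ ↦ h𝒟 k j
  · rw [IdealSheafData.comap_comp, IdealSheafData.comap_comp]
    obtain h | h := le_or_gt s.1 k
    · have h1 : (𝒟.Y s.1).comap (𝒟.Y k).subschemeι = ⊥ := by
        rw [eq_bot_iff, ← IdealSheafData.le_map_iff_comap_le, IdealSheafData.map_bot,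
          IdealSheafData.ker_subschemeι]
        exact 𝒟.monotone_Y h
      change ((𝒟.Y s.1).comap (𝒟.Y k).subschemeι).comap _ ≤ _
      rw [h1, IdealSheafData.comap_bot]
      exact bot_le
    · have h2 := (𝒟.pieceCenter S k).deformationCenter.comap_Y_le
        ⟨s.1, Finset.mem_filter.mpr ⟨s.2, h⟩⟩
      rwa [𝒟.pieceCenter_D S k _ s.2] at h2

/-- The unique `X`-morphism from the deformation space over `Y k` of the data with `s ∈ S`, `s > k`,
to the deformation space over `X` of the data with `s ∈ S`. -/
noncomputable def pieceHom (h𝒟 : 𝒟.IsRegular) (S : Finset I) (k : I) :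
    𝒟.piece S k ⟶ 𝒟.partialSpace S :=
  (𝒟.existsUnique_pieceHom h𝒟 S k).choose

theorem pieceHom_partialMap (h𝒟 : 𝒟.IsRegular) (S : Finset I) (k : I) :
    𝒟.pieceHom h𝒟 S k ≫ 𝒟.partialMap S = 𝒟.pieceMap S k :=
  (𝒟.existsUnique_pieceHom h𝒟 S k).choose_spec.1

/-- The morphism `pieceHom` is a closed immersion, hence its source is identified with the closed
subscheme of its target with ideal sheaf the kernel of `pieceHom`. -/
instance isClosedImmersion_pieceHom (h𝒟 : 𝒟.IsRegular) (S : Finset I) (k : I) :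
    IsClosedImmersion (𝒟.pieceHom h𝒟 S k) :=
  MultiCenter.isClosedImmersion_of_comap (𝒟.restrict S).deformationCenter
    (𝒟.pieceCenter S k).deformationCenter (𝒟.Y k).subschemeι
    (fun s ↦ ⟨s.1, (Finset.mem_filter.mp s.2).1⟩)
    (fun s ↦ 𝒟.pieceCenter_D S k s (Finset.mem_filter.mp s.2).1) (fun _ ↦ rfl) _
    (𝒟.pieceHom_partialMap h𝒟 S k)

/-- The intersection of the divisors `D s` with `s ∈ S`. -/
noncomputable abbrev inter (S : Finset I) : X.IdealSheafData :=
  ⨆ s ∈ S, 𝒟.D s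

/-- The stratum of an `X`-scheme `O`: its base change to the intersection of the `D s`, `s ∈ S`. -/
noncomputable abbrev stratum (S : Finset I) {O : Scheme.{u}} (p : O ⟶ X) : Scheme.{u} :=
  pullback p (𝒟.inter S).subschemeι

/-- The morphism induced on strata by a morphism of `X`-schemes. -/
noncomputable abbrev stratumMap (S : Finset I) {O O' : Scheme.{u}} {p : O ⟶ X} {p' : O' ⟶ X}
    (f : O ⟶ O') (hf : f ≫ p' = p) : 𝒟.stratum S p ⟶ 𝒟.stratum S p' :=
  pullback.map p (𝒟.inter S).subschemeι p' (𝒟.inter S).subschemeι f (𝟙 _) (𝟙 _)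
    (by rw [hf, Category.comp_id]) (by simp)

variable [Fintype I]

/-- The multi-center data, indexed by `k ∉ S`, defining the panel over `partialSpace`: the closed
subschemes are the deformation spaces over the `Y k`, the divisors are the pullbacks of the
`D k`. -/
noncomputable def panelCenter (h𝒟 : 𝒟.IsRegular) (S : Finset I) :
    MultiCenter (𝒟.partialSpace S) ↥Sᶜ where
  Y k := (𝒟.pieceHom h𝒟 S k).ker
  D k := (𝒟.D k).comap (𝒟.partialMap S)
  isLocallyPrincipal k := (𝒟.isLocallyPrincipal k).comap _

/-- The `S`-panel, an iterated deformation space. -/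
noncomputable abbrev panel (h𝒟 : 𝒟.IsRegular) (S : Finset I) : Scheme.{u} :=
  (𝒟.panelCenter h𝒟 S).deformationSpace

/-- The structure map of the panel as a scheme over `X`. -/
noncomputable abbrev panelMap (h𝒟 : 𝒟.IsRegular) (S : Finset I) : 𝒟.panel h𝒟 S ⟶ X :=
  (𝒟.panelCenter h𝒟 S).deformationMap ≫ 𝒟.partialMap S

/-- The analogue of `panelCenter` after base change to the intersection of the `D s`, `s ∈ S`. -/
noncomputable def stratumCenter (h𝒟 : 𝒟.IsRegular) (S : Finset I) :
    MultiCenter (𝒟.stratum S (𝒟.partialMap S)) ↥Sᶜ where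
  Y k := (𝒟.stratumMap S (𝒟.pieceHom h𝒟 S k) (𝒟.pieceHom_partialMap h𝒟 S k)).ker
  D k := (𝒟.D k).comap (pullback.fst _ _ ≫ 𝒟.partialMap S)
  isLocallyPrincipal k := (𝒟.isLocallyPrincipal k).comap _

end DeformationDatum

end AlgebraicGeometry.Scheme

/-!
The stratum of the panel is the base change of a dilatation, and dilatations commute with any base
change after which the divisors remain Cartier. This follows from the universal property alone
(`MultiCenter.existsUnique_iso_of_isPullback`): if `T` is the base change to `X'` of a dilatation
of `X`, then the centers on `T` lie in the divisors by functoriality, so once the divisors of `T`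
are Cartier `T` maps to the dilatation of `X'`; conversely the dilatation of `X'` maps to that of
`X`, hence to `T`. The uniqueness parts of the universal properties show that the two maps are
mutually inverse.

To apply this with `X = partialSpace S` and `X'` its stratum, two identifications are needed. The
multi-center on the stratum is the pullback of the multi-center defining the panel
(`DeformationDatum.stratumCenter_eq_comap`), since the kernel of a closed immersion commutes with
base change. The stratum of the panel is the fibre product of the panel with the stratum of
`partialSpace S` (`DeformationDatum.isPullback_stratumMap`). The hypothesis on the panel says that
the pullbacks of the single `D k` to its stratum are Cartier, hence so are the products of them
which form the divisors of the deformation space.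
-/

namespace AlgebraicGeometry.Scheme

theorem IdealSheafData.ker_eq_comap_of_isPullback {X Y Z W : Scheme.{u}} {iX : W ⟶ X} {g : W ⟶ Z}
    {f : X ⟶ Y} {iY : Z ⟶ Y} [IsClosedImmersion iY] (h : IsPullback iX g f iY) :
    iX.ker = iY.ker.comap f := by
  rw [← ker_fst_of_isClosedImmersion, ← Hom.ker_comp_of_isIso h.isoPullback.hom,
    IsPullback.isoPullback_hom_fst]

namespace MultiCenter

theorem deformationCenter_comap {X X' : Scheme.{u}} {ι : Type v} [LinearOrder ι] [Fintype ι]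
    (C : MultiCenter X ι) (f : X' ⟶ X) :
    (C.comap f).deformationCenter = C.deformationCenter.comap f := by
  have h : (C.comap f).deformationCenter.D = (C.deformationCenter.comap f).D :=
    funext (C.deformationCenter_comap_D f)
  rw [MultiCenter.mk.injEq]
  exact ⟨rfl, h⟩

/-- Dilatations commute with base change if the pullbacks of the divisors to the base change of
the dilatation are Cartier. -/
theorem existsUnique_iso_of_isPullback {X X' T : Scheme.{u}} {ι : Type v} [Finite ι]
    (C : MultiCenter X ι) {f : X' ⟶ X} {g : T ⟶ C.dilatation} {p : T ⟶ X'}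
    (h : IsPullback g p C.toBase f) (hreg : ∀ i, (((C.D i).comap f).comap p).IsCartier) :
    ∃! φ : T ≅ (C.comap f).dilatation, φ.hom ≫ (C.comap f).toBase = p := by
  obtain ⟨a, ha, ha'⟩ := (C.comap f).existsUnique_lift p hreg fun i ↦ by
    change ((C.Y i).comap f).comap p ≤ ((C.D i).comap f).comap p
    rw [← IdealSheafData.comap_comp, ← IdealSheafData.comap_comp, ← h.w,
      IdealSheafData.comap_comp, IdealSheafData.comap_comp]
    exact IdealSheafData.comap_mono g (C.comap_Y_le i)
  obtain ⟨b, hb, -⟩ := C.existsUnique_lift ((C.comap f).toBase ≫ f)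
    (fun i ↦ by
      rw [IdealSheafData.comap_comp]
      exact (C.comap f).isCartier_comap_D i)
    (fun i ↦ by
      rw [IdealSheafData.comap_comp, IdealSheafData.comap_comp]
      exact (C.comap f).comap_Y_le i)
  let c : (C.comap f).dilatation ⟶ T := h.lift b (C.comap f).toBase hb
  have hc : c ≫ p = (C.comap f).toBase := h.lift_snd _ _ _
  have hcg : c ≫ g = b := h.lift_fst _ _ _
  refine ⟨⟨a, c, h.hom_ext (C.hom_ext _ _ ?_ fun i ↦ ?_) ?_, (C.comap f).hom_ext _ _ ?_ fun i ↦ ?_⟩,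
    ha, fun φ hφ ↦ Iso.ext (ha' _ hφ)⟩
  · simp only [Category.assoc, Category.id_comp]
    rw [reassoc_of% hcg, hb, reassoc_of% ha, h.w]
  · have e : ((a ≫ c) ≫ g) ≫ C.toBase = p ≫ f := by
      simp only [Category.assoc]
      rw [reassoc_of% hcg, hb, reassoc_of% ha]
    rw [e, IdealSheafData.comap_comp]
    exact hreg i
  · rw [Category.assoc, hc, ha, Category.id_comp]
  · rw [Category.assoc, ha, hc, Category.id_comp]
  · rw [Category.assoc, ha, hc]
    exact (C.comap f).isCartier_comap_D i

/-- Deformation spaces commute with base change if the pullbacks of the given `D i`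
to the base change of the deformation space are Cartier. -/
theorem existsUnique_deformationSpace_iso_of_isPullback {X X' T : Scheme.{u}} {ι : Type v}
    [LinearOrder ι] [Fintype ι] (C : MultiCenter X ι) {f : X' ⟶ X} {g : T ⟶ C.deformationSpace}
    {p : T ⟶ X'} (h : IsPullback g p C.deformationMap f)
    (hreg : ∀ i, (((C.D i).comap f).comap p).IsCartier) :
    ∃! φ : T ≅ (C.comap f).deformationSpace, φ.hom ≫ (C.comap f).deformationMap = p := by
  change ∃! φ : T ≅ (C.comap f).deformationCenter.dilatation,
    φ.hom ≫ (C.comap f).deformationCenter.toBase = p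
  rw [deformationCenter_comap]
  refine C.deformationCenter.existsUnique_iso_of_isPullback h fun i ↦ ?_
  rw [← deformationCenter_comap_D]
  change ((∏ j : ι with i ≤ j, (C.D j).comap f).comap p).IsCartier
  rw [IdealSheafData.comap_prod]
  exact .prod _ fun j _ ↦ hreg j

end MultiCenter

namespace DeformationDatum

variable {X : Scheme.{u}} {I : Type v} [LinearOrder I] (𝒟 : DeformationDatum X I)

theorem isPullback_stratumMap (S : Finset I) {O O' : Scheme.{u}} {p : O ⟶ X} {p' : O' ⟶ X}
    (f : O ⟶ O') (hf : f ≫ p' = p) :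
    IsPullback (pullback.fst p (𝒟.inter S).subschemeι) (𝒟.stratumMap S f hf) f
      (pullback.fst p' (𝒟.inter S).subschemeι) := by
  refine IsPullback.flip (IsPullback.of_right (h₁₂ := pullback.snd p' _) (h₂₂ := p')
    (v₁₃ := (𝒟.inter S).subschemeι) ?_ (pullback.lift_fst _ _ _)
    (IsPullback.of_hasPullback p' (𝒟.inter S).subschemeι).flip)
  have e : 𝒟.stratumMap S f hf ≫ pullback.snd p' (𝒟.inter S).subschemeι =
      pullback.snd p (𝒟.inter S).subschemeι :=
    (pullback.lift_snd _ _ _).trans (Category.comp_id _)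
  rw [e, hf]
  exact (IsPullback.of_hasPullback p (𝒟.inter S).subschemeι).flip

theorem stratumCenter_eq_comap [Fintype I] (h𝒟 : 𝒟.IsRegular) (S : Finset I) :
    𝒟.stratumCenter h𝒟 S = (𝒟.panelCenter h𝒟 S).comap (pullback.fst _ _) := by
  rw [MultiCenter.mk.injEq]
  refine ⟨funext fun k ↦ ?_, funext fun k ↦ IdealSheafData.comap_comp _ _ _⟩
  exact IdealSheafData.ker_eq_comap_of_isPullback
    (𝒟.isPullback_stratumMap S _ (𝒟.pieceHom_partialMap h𝒟 S k)).flip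

end DeformationDatum

end AlgebraicGeometry.Scheme

theorem mainTheorem3 {X : Scheme.{u}} {I : Type v} [LinearOrder I] [Fintype I]
    (𝒟 : Scheme.DeformationDatum X I) (h𝒟 : 𝒟.IsRegular) (S : Finset I)
    (hS : ∀ k ∉ S, (((𝒟.D k).comap (𝒟.inter S).subschemeι).comap
      (pullback.snd (𝒟.panelMap h𝒟 S) (𝒟.inter S).subschemeι)).IsCartier) :
    ∃! φ : 𝒟.stratum S (𝒟.panelMap h𝒟 S) ≅ (𝒟.stratumCenter h𝒟 S).deformationSpace,
      φ.hom ≫ (𝒟.stratumCenter h𝒟 S).deformationMap =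
        𝒟.stratumMap S (p := 𝒟.panelMap h𝒟 S) (p' := 𝒟.partialMap S)
          (𝒟.panelCenter h𝒟 S).deformationMap rfl := by
  rw [𝒟.stratumCenter_eq_comap h𝒟 S]
  refine (𝒟.panelCenter h𝒟 S).existsUnique_deformationSpace_iso_of_isPullback
    (𝒟.isPullback_stratumMap S (𝒟.panelCenter h𝒟 S).deformationMap rfl) fun k ↦ ?_
  -- The hypothesis and the goal concern the pullback of `D k` to the stratum of the panel along
  -- the two sides of a commutative square.
  have h := hS k (Finset.mem_compl.mp k.2)
  rw [← Scheme.IdealSheafData.comap_comp, ← pullback.condition] at h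
  change ((((𝒟.D k).comap (𝒟.partialMap S)).comap (pullback.fst _ _)).comap _).IsCartier
  rwa [← Scheme.IdealSheafData.comap_comp, ← Scheme.IdealSheafData.comap_comp,
    ← (𝒟.isPullback_stratumMap S (𝒟.panelCenter h𝒟 S).deformationMap rfl).w, Category.assoc]
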